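/- Let $1<p<\infty$, $0<\rho\le 1$, $\tau\ge 1$, $\eta>0$ and $c\ge 0$. There is a constant $C\in(0,\infty)$, depending only on $p,\rho,\tau,\eta$ and $c$, such that the following holds. Let $(X,d)$ be a metric space with a Borel regular measure $\mu$ such that $0<\mu(B)<\infty$ and $\mu(2B)\le c\,\mu(B)$ for all balls $B$. (A ball is an open ball $B=B(x,r)$ with a given center $x$ and radius $r\in(0,\infty)$; we write $\lambda B:=B(x,\lambda r)$ and $\widehat B:=(1+\eta)B$.) Then for every ball $B\subset X$ and every real-valued $f\in L^\rho(\tau\widehat B)$, $$\|f-f_B\|_{L^{p,\infty},B}\le C\,\|f\|_{JN^\rho_{p,\tau},\tau\widehat B},$$ where $f_B=\frac1{\mu(B)}\int_B f\,d\mu$; moreover $f\in L^1(B)$, so that $f_B$ is well defined, whenever the right-hand side is finite (otherwise the inequality is trivial). Here $$\|g\|_{L^{p,\infty},B}:=\sup_{t>0}\,t\left(\frac{\mu(\{x\in B:|g(x)|>t\})}{\mu(B)}\right)^{1/p}$$ and, for a ball $A$, $$\|f\|_{JN^\rho_{p,\tau},A}:=\sup\left(\frac1{\mu(A)}\sum_i\Big(\inf_{c'\in\mathbb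 R}\frac1{\mu(B_i)}\int_{B_i}|f-c'|^\rho\,d\mu\Big)^{p/\rho}\mu(\tau B_i)\right)^{1/p},$$ the supremum being taken over all families of balls $\{B_i\}_i$ such that the dilates $\tau B_i$ are pairwise disjoint and contained in $A$. -/

import Mathlib

open MeasureTheory Metric
open scoped NNReal ENNReal

noncomputable section

/-- `μ` is a doubling measure with constant `c`: all balls have positive and finite measure, and
`μ (2B) ≤ c μ B` for every ball `B`. -/
structure IsDoublingWith {X : Type*} [MetricSpace X] [MeasurableSpace X]
    (μ : Measure X) (c : ℝ≥0) : Prop where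
  ball_pos : ∀ (x : X) (r : ℝ), 0 < r → 0 < μ (ball x r)
  ball_lt_top : ∀ (x : X) (r : ℝ), 0 < r → μ (ball x r) < ∞
  doubling : ∀ (x : X) (r : ℝ), 0 < r → μ (ball x (2 * r)) ≤ c * μ (ball x r)

/-- The normalized weak `L^p` quasinorm `‖g‖_{L^{p,∞}, A}`, that is, the weak `L^p` quasinorm of `g`
on `A` with respect to the measure `dμ / μ A`. -/
def weakLpNorm {X : Type*} [MeasurableSpace X] (μ : Measure X) (p : ℝ) (A : Set X)
    (g : X → ℝ) : ℝ≥0∞ :=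
  ⨆ t : ℝ≥0, (t : ℝ≥0∞) * (μ {x ∈ A | (t : ℝ≥0∞) < ‖g x‖ₑ} / μ A) ^ (1 / p)

/-- The `L^ρ` oscillation `inf_{c ∈ ℝ} ⨍_A |f - c|^ρ dμ`. -/
def lpOscillation {X : Type*} [MeasurableSpace X] (μ : Measure X) (ρ : ℝ) (A : Set X)
    (f : X → ℝ) : ℝ≥0∞ :=
  ⨅ c : ℝ, ⨍⁻ x in A, ‖f x - c‖ₑ ^ ρ ∂μ

/-- A family of balls, each given by its center and its positive radius, whose `τ`-dilates are
pairwise disjoint and contained in `A`. -/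
structure IsAdmissibleFamily {X : Type*} [MetricSpace X] (τ : ℝ) (A : Set X)
    (S : Set (X × ℝ)) : Prop where
  radius_pos : ∀ b ∈ S, 0 < b.2
  subset : ∀ b ∈ S, ball b.1 (τ * b.2) ⊆ A
  disjoint : S.PairwiseDisjoint fun b => ball b.1 (τ * b.2)

/-- The generalized John-Nirenberg functional `‖f‖_{JN^ρ_{p,τ}, A}` (for `A` a ball). -/
def jnNorm {X : Type*} [MetricSpace X] [MeasurableSpace X] (μ : Measure X) (p τ ρ : ℝ)
    (A : Set X) (f : X → ℝ) : ℝ≥0∞ :=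
  ⨆ (S : Set (X × ℝ)) (_ : IsAdmissibleFamily τ A S),
    ((∑' b : S, lpOscillation μ ρ (ball b.1.1 b.1.2) f ^ (p / ρ) *
      μ (ball b.1.1 (τ * b.1.2))) / μ A) ^ (1 / p)

end

open Set Filter Topology

/-! ### Consequences of doubling: countability and covering. -/

namespace IsDoublingWith

variable {X : Type*} [MetricSpace X] [MeasurableSpace X] {μ : Measure X} {c : ℝ≥0}

/-! Since `ρ ≤ 1`, `|a - b| ^ ρ` satisfies the triangle inequality, so the whole argument runs with
this distance and the exponent `q = p / ρ`. The number `c₀` is a near minimizer of the oscillation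
on the ball of radius `(1 + η) * r`.

Points around which some dyadic ball has oscillation at least `θ * L` form a bad set. A Vitali
selection among the `τ`-dilates of these balls is admissible, so the John-Nirenberg functional
bounds the measure of the bad set by a multiple of `(θ * L) ^ (-q)` (`measure_lpOscillation_ge_le`).
At a good Lebesgue point where `|f - c₀| ^ ρ > N * L`, near minimizers on dyadic balls move slowly
from near `c₀` to `f x`. Stopping where they leave the `2 * L`-neighbourhood of `c₀` gives a small
ball at least half filled by the level set of `L`, whose enlargement meets the level set of `N * L`
in only a fraction `θ` (`exists_stopping_radius`). Covering yields the good-`λ` inequality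
`measure_levelSet_le`.

For small `θ` it iterates upwards along the levels `N ^ i`, from a trivial bound at the lowest one.
No a priori finiteness is needed, and each step costs only a slight shrinking of the ball, which the
room `η` pays for. Hence `f - c₀` is in weak `L^p`; since `p > 1`, it is integrable and `c₀` may be
replaced by the mean. -/

theorem one_le (h : IsDoublingWith μ c) (x : X) : 1 ≤ c := by
  have h1 : μ (ball x 1) ≤ c * μ (ball x 1) :=
    (measure_mono (ball_subset_ball (by norm_num))).trans (h.doubling x 1 one_pos)
  by_contra hc
  have h2 : (c : ℝ≥0∞) * μ (ball x 1) < 1 * μ (ball x 1) :=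
    ENNReal.mul_lt_mul_left (h.ball_pos x 1 one_pos).ne' (h.ball_lt_top x 1 one_pos).ne
      (by exact_mod_cast not_le.1 hc)
  rw [one_mul] at h2
  exact absurd h1 (not_le.2 h2)

theorem measure_ball_two_pow_mul (h : IsDoublingWith μ c) (x : X) {r : ℝ} (hr : 0 < r) (k : ℕ) :
    μ (ball x (2 ^ k * r)) ≤ c ^ k * μ (ball x r) := by
  induction k with
  | zero => simp
  | succ k ih =>
    calc μ (ball x (2 ^ (k + 1) * r)) = μ (ball x (2 * (2 ^ k * r))) := by ring_nf
      _ ≤ c * μ (ball x (2 ^ k * r)) := h.doubling x _ (by positivity)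
      _ ≤ c * (c ^ k * μ (ball x r)) := by gcongr
      _ = c ^ (k + 1) * μ (ball x r) := by ring

theorem measure_le_of_subset (h : IsDoublingWith μ c) {s : Set X} (x : X) {r : ℝ} (hr : 0 < r)
    {R : ℝ} (hs : s ⊆ ball x R) {k : ℕ} (hk : R ≤ 2 ^ k * r) :
    μ s ≤ c ^ k * μ (ball x r) :=
  (measure_mono (hs.trans (ball_subset_ball hk))).trans (h.measure_ball_two_pow_mul x hr k)

theorem isLocallyFiniteMeasure (h : IsDoublingWith μ c) : IsLocallyFiniteMeasure μ :=
  ⟨fun x => ⟨ball x 1, ball_mem_nhds x one_pos, h.ball_lt_top x 1 one_pos⟩⟩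

theorem isUnifLocDoublingMeasure (h : IsDoublingWith μ c) : IsUnifLocDoublingMeasure μ := by
  refine ⟨⟨c ^ 2, ?_⟩⟩
  filter_upwards [self_mem_nhdsWithin] with ε hε x
  have hε : 0 < ε := hε
  calc μ (closedBall x (2 * ε)) ≤ c ^ 2 * μ (ball x ε) :=
        h.measure_le_of_subset x hε (closedBall_subset_ball (by linarith : 2 * ε < 4 * ε))
          (by norm_num)
    _ ≤ (c ^ 2 : ℝ≥0) * μ (closedBall x ε) := by
        push_cast
        gcongr
        exact ball_subset_closedBall

theorem sigmaFinite (h : IsDoublingWith μ c) [OpensMeasurableSpace X] : SigmaFinite μ := by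
  rcases isEmpty_or_nonempty X with hX | ⟨⟨x⟩⟩
  · rw [Measure.eq_zero_of_isEmpty μ]; infer_instance
  · refine ⟨⟨⟨fun n => ball x (n + 1), fun _ => trivial,
      fun n => h.ball_lt_top x _ (by positivity), ?_⟩⟩⟩
    refine eq_univ_of_forall fun y => ?_
    obtain ⟨n, hn⟩ := exists_nat_gt (dist y x)
    exact mem_iUnion.2 ⟨n, by rw [mem_ball]; linarith⟩

/-- A σ-finite measure admits only countably many disjoint measurable sets of positive measure. -/
theorem countable_of_pairwiseDisjoint (h : IsDoublingWith μ c) [OpensMeasurableSpace X]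
    {ι : Type*} {u : Set ι} {x : ι → X} {r : ι → ℝ} (hr : ∀ i ∈ u, 0 < r i)
    (hd : u.PairwiseDisjoint fun i => ball (x i) (r i)) : u.Countable := by
  have := h.sigmaFinite
  have hc := Measure.countable_meas_pos_of_disjoint_iUnion (μ := μ)
    (As := fun i : u => ball (x i) (r i)) (fun i => measurableSet_ball) (hd.subtype _ _)
  have he : {i : u | 0 < μ (ball (x i) (r i))} = univ :=
    eq_univ_of_forall fun i => h.ball_pos _ _ (hr i i.2)
  rw [he, countable_univ_iff] at hc
  exact hc.to_set

/-- The centers of a Vitali family of disjoint balls of radius `ε / 4` are countable and `ε`-dense.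
The differentiation theorem below relies on this. -/
theorem secondCountableTopology (h : IsDoublingWith μ c) [OpensMeasurableSpace X] :
    SecondCountableTopology X := by
  refine Metric.secondCountable_of_almost_dense_set fun ε hε => ?_
  obtain ⟨u, -, hd, hu⟩ := Vitali.exists_disjoint_subfamily_covering_enlargement_closedBall
    (univ : Set X) id (fun _ => ε / 4) (ε / 4) (fun _ _ => le_rfl) 4 (by norm_num)
  refine ⟨u, h.countable_of_pairwiseDisjoint (x := id) (r := fun _ => ε / 4)
    (fun _ _ => by positivity) (hd.mono fun _ => ball_subset_closedBall), fun x => ?_⟩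
  obtain ⟨y, hy, hxy⟩ := hu x (mem_univ x)
  refine ⟨y, hy, ?_⟩
  have := hxy (mem_closedBall_self (by positivity))
  simpa [mem_closedBall, mul_div_cancel₀] using this

end IsDoublingWith

/-- The snowflaked distance `|a - b| ^ ρ` on the real line. -/
noncomputable def powDist (ρ a b : ℝ) : ℝ≥0∞ := ‖a - b‖ₑ ^ ρ

/-! ### The metric `|a - b| ^ ρ` and near minimizers of the oscillation. -/

section powDist

variable {ρ : ℝ}

theorem powDist_comm (a b : ℝ) : powDist ρ a b = powDist ρ b a := by
  rw [powDist, powDist, ← enorm_neg, neg_sub]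

theorem powDist_self (hρ : 0 < ρ) (a : ℝ) : powDist ρ a a = 0 := by
  simp [powDist, hρ]

theorem powDist_triangle (hρ : 0 < ρ) (hρ' : ρ ≤ 1) (a b d : ℝ) :
    powDist ρ a d ≤ powDist ρ a b + powDist ρ b d := by
  calc ‖a - d‖ₑ ^ ρ = ‖(a - b) + (b - d)‖ₑ ^ ρ := by ring_nf
    _ ≤ (‖a - b‖ₑ + ‖b - d‖ₑ) ^ ρ := by gcongr; exact enorm_add_le _ _
    _ ≤ _ := ENNReal.rpow_add_le_add_rpow _ _ hρ.le hρ'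

theorem exists_rat_powDist_lt (hρ : 0 < ρ) (a : ℝ) {ε : ℝ≥0∞} (hε : 0 < ε) :
    ∃ q : ℚ, powDist ρ a q < ε := by
  have hcont : Continuous fun b : ℝ => powDist ρ a b :=
    (ENNReal.continuous_rpow_const).comp (by fun_prop)
  have hopen : IsOpen {b : ℝ | powDist ρ a b < ε} := isOpen_lt hcont continuous_const
  exact Rat.denseRange_cast.exists_mem_open hopen ⟨a, by simpa [powDist_self hρ] using hε⟩

variable {X : Type*} [MeasurableSpace X] {μ : Measure X} {f : X → ℝ} {s t : Set X}

theorem aemeasurable_powDist (hf : AEMeasurable f (μ.restrict s)) (a : ℝ) :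
    AEMeasurable (fun y => powDist ρ (f y) a) (μ.restrict s) :=
  ((hf.sub_const a).enorm).pow_const ρ

theorem exists_lintegral_powDist_le {b : ℝ≥0∞} (hs : μ s ≠ 0) (hs' : μ s ≠ ∞)
    (h : lpOscillation μ ρ s f < b) : ∃ a, ∫⁻ y in s, powDist ρ (f y) a ∂μ ≤ b * μ s := by
  obtain ⟨a, ha⟩ := iInf_lt_iff.1 h
  refine ⟨a, ?_⟩
  rw [setLAverage_eq] at ha
  exact ((ENNReal.div_le_iff hs hs').1 ha.le)

/-- Near minimizers on nested sets of comparable measure are close: integrate the triangle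
inequality through `f y` over the smaller set. -/
theorem powDist_le_of_lintegral_le (hρ : 0 < ρ) (hρ' : ρ ≤ 1)
    (hf : AEMeasurable f (μ.restrict s)) (hs : μ s ≠ 0) (hs' : μ s ≠ ∞) (hst : s ⊆ t)
    {κ α β : ℝ≥0∞} (ht : μ t ≤ κ * μ s) {a b : ℝ}
    (ha : ∫⁻ y in s, powDist ρ (f y) a ∂μ ≤ α * μ s)
    (hb : ∫⁻ y in t, powDist ρ (f y) b ∂μ ≤ β * μ t) :
    powDist ρ a b ≤ α + κ * β := by
  rw [← ENNReal.mul_le_mul_iff_left hs hs']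
  calc powDist ρ a b * μ s = ∫⁻ _ in s, powDist ρ a b ∂μ := by simp
    _ ≤ ∫⁻ y in s, powDist ρ (f y) a + powDist ρ (f y) b ∂μ := by
        refine lintegral_mono fun y => ?_
        rw [powDist_comm (f y) a]
        exact powDist_triangle hρ hρ' _ _ _
    _ = ∫⁻ y in s, powDist ρ (f y) a ∂μ + ∫⁻ y in s, powDist ρ (f y) b ∂μ :=
        lintegral_add_left' (aemeasurable_powDist hf a) _
    _ ≤ α * μ s + ∫⁻ y in t, powDist ρ (f y) b ∂μ := by gcongr
    _ ≤ α * μ s + β * (κ * μ s) := by gcongr; exact hb.trans (by gcongr)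
    _ = (α + κ * β) * μ s := by ring

theorem measure_powDist_le (hf : AEMeasurable f (μ.restrict s)) {a : ℝ} {L β : ℝ≥0∞}
    (hL : L ≠ 0) (hL' : L ≠ ∞)
    (ha : ∫⁻ y in s, powDist ρ (f y) a ∂μ ≤ β * L * μ s) (hsm : MeasurableSet s) :
    μ (s ∩ {y | L ≤ powDist ρ (f y) a}) ≤ β * μ s := by
  rw [← ENNReal.mul_le_mul_iff_right hL hL']
  calc L * μ (s ∩ {y | L ≤ powDist ρ (f y) a})
      = L * μ.restrict s {y | L ≤ powDist ρ (f y) a} := by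
        rw [Measure.restrict_apply' hsm, inter_comm]
    _ ≤ ∫⁻ y in s, powDist ρ (f y) a ∂μ :=
        mul_meas_ge_le_lintegral₀ (aemeasurable_powDist hf a) L
    _ ≤ β * L * μ s := ha
    _ = L * (β * μ s) := by ring

end powDist

/-! ### Lebesgue points, the sharp maximal function and the stopping index. -/

section

variable {X : Type*} [MetricSpace X] [MeasurableSpace X] [BorelSpace X] {μ : Measure X} {c : ℝ≥0}
  {f : X → ℝ} {ρ : ℝ}

/-- Almost every point of an open set of finite measure is an `L^ρ` Lebesgue point. -/
theorem IsDoublingWith.ae_eventually_lintegral_powDist_le (h : IsDoublingWith μ c)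
    (hρ : 0 < ρ) (hρ' : ρ ≤ 1) {A : Set X} (hA : IsOpen A) (hμA : μ A ≠ ∞)
    (hf : AEMeasurable f (μ.restrict A)) (hfA : ∫⁻ y in A, powDist ρ (f y) 0 ∂μ ≠ ∞) :
    ∀ᵐ y ∂μ, y ∈ A → ∀ ε : ℝ≥0∞, 0 < ε → ∀ᶠ s in 𝓝[>] (0 : ℝ),
      ∫⁻ z in ball y s, powDist ρ (f z) (f y) ∂μ ≤ ε * μ (ball y s) := by
  have := h.isLocallyFiniteMeasure
  have := h.isUnifLocDoublingMeasure
  have := h.secondCountableTopology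
  -- Differentiation is applied for rational constants only, so that the exceptional null sets are
  -- countably many; `f y` is then approximated by a rational.
  have key : ∀ q : ℚ, ∀ᵐ y ∂μ, Tendsto
      (fun a => (∫⁻ z in a, A.indicator (fun z => powDist ρ (f z) q) z ∂μ) / μ a)
      ((IsUnifLocDoublingMeasure.vitaliFamily μ 1).filterAt y)
      (𝓝 (A.indicator (fun z => powDist ρ (f z) q) y)) := by
    intro q
    refine VitaliFamily.ae_tendsto_lintegral_div _
      ((aemeasurable_indicator_iff hA.measurableSet).2 (aemeasurable_powDist hf _)) ?_
    rw [lintegral_indicator hA.measurableSet]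
    refine ne_top_of_le_ne_top ?_ (lintegral_mono fun y =>
      powDist_triangle hρ hρ' (f y) 0 (q : ℝ))
    rw [lintegral_add_left' (aemeasurable_powDist hf 0), lintegral_const,
      Measure.restrict_apply_univ]
    have : powDist ρ 0 (q : ℝ) ≠ ∞ := ENNReal.rpow_ne_top_of_nonneg hρ.le enorm_ne_top
    exact ENNReal.add_ne_top.2 ⟨hfA, ENNReal.mul_ne_top this hμA⟩
  filter_upwards [ae_all_iff.2 key] with y hy hyA ε hε
  have hc1 : (c : ℝ≥0∞) + 1 ≠ 0 := by simp
  have hc2 : (c : ℝ≥0∞) + 1 ≠ ∞ := by simp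
  -- In the divisor `c + 1`, the `c` pays for passing from closed to open balls and the `1` for
  -- replacing `q` by `f y`.
  obtain ⟨q, hq⟩ := exists_rat_powDist_lt hρ (f y) (ENNReal.div_pos hε.ne' hc2)
  have hlim := (hy q).comp (IsUnifLocDoublingMeasure.tendsto_closedBall_filterAt μ (K := 1)
    (x := y) (l := 𝓝[>] (0 : ℝ)) (fun _ => y) id tendsto_id (by
      filter_upwards [self_mem_nhdsWithin] with s hs
      exact mem_closedBall_self (by simpa using (mem_Ioi.1 hs).le)))
  rw [indicator_of_mem hyA] at hlim
  have hsub : ∀ᶠ s in 𝓝[>] (0 : ℝ), closedBall y s ⊆ A :=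
    (Metric.nhds_basis_closedBall.mem_iff.1 (hA.mem_nhds hyA)).elim fun r hr => by
      filter_upwards [Ioo_mem_nhdsGT hr.1] with s hs
      exact (closedBall_subset_closedBall hs.2.le).trans hr.2
  filter_upwards [hlim.eventually_lt_const hq, hsub, self_mem_nhdsWithin] with s hs hsA hs0
  have hs0 : 0 < s := hs0
  have hcl : μ (closedBall y s) ≤ c * μ (ball y s) := by
    simpa using h.measure_le_of_subset y hs0 (k := 1)
      (closedBall_subset_ball (by linarith : s < 2 * s)) (by simp)
  have hb0 : μ (closedBall y s) ≠ 0 :=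
    ((h.ball_pos y s hs0).trans_le (measure_mono ball_subset_closedBall)).ne'
  have hb1 : μ (closedBall y s) ≠ ∞ :=
    ne_top_of_le_ne_top (ENNReal.mul_ne_top ENNReal.coe_ne_top (h.ball_lt_top y s hs0).ne) hcl
  have hI := (ENNReal.div_le_iff hb0 hb1).1 hs.le
  simp only [id] at hI
  calc ∫⁻ z in ball y s, powDist ρ (f z) (f y) ∂μ
      ≤ ∫⁻ z in ball y s, powDist ρ (f z) q + powDist ρ q (f y) ∂μ :=
        lintegral_mono fun z => powDist_triangle hρ hρ' _ _ _
    _ = ∫⁻ z in ball y s, powDist ρ (f z) q ∂μ + powDist ρ q (f y) * μ (ball y s) := by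
        rw [lintegral_add_right _ measurable_const]; simp
    _ ≤ ∫⁻ z in closedBall y s, A.indicator (fun z => powDist ρ (f z) q) z ∂μ
          + ε / (c + 1) * μ (ball y s) := by
        gcongr ?_ + ?_ * _
        · rw [setLIntegral_congr_fun (g := fun z => powDist ρ (f z) q) measurableSet_closedBall
            (fun z hz => indicator_of_mem (hsA hz) _)]
          exact lintegral_mono_set ball_subset_closedBall
        · rw [powDist_comm]; exact hq.le
    _ ≤ ε / (c + 1) * (c * μ (ball y s)) + ε / (c + 1) * μ (ball y s) := by
        gcongr ?_ + _
        exact hI.trans (by gcongr)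
    _ = ε / (c + 1) * (c + 1) * μ (ball y s) := by ring
    _ = ε * μ (ball y s) := by rw [ENNReal.div_mul_cancel hc1 hc2]

/-- Weak type bound for the local sharp maximal function. -/
theorem IsDoublingWith.measure_lpOscillation_ge_le (h : IsDoublingWith μ c) {τ q : ℝ}
    (hτ : 1 ≤ τ) (hq : 0 < q) {A T : Set X} {M b : ℝ≥0∞} {δ : ℝ} (hδ : 0 < δ)
    (hJN : ∀ S, IsAdmissibleFamily τ A S →
      ∑' b : S, lpOscillation μ ρ (ball b.1.1 b.1.2) f ^ q * μ (ball b.1.1 (τ * b.1.2)) ≤ M)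
    (hT : ∀ x ∈ T, ball x (τ * δ) ⊆ A) :
    b ^ q * μ {x ∈ T | ∃ j : ℕ, b ≤ lpOscillation μ ρ (ball x (δ / 2 ^ j)) f} ≤ c ^ 3 * M := by
  have hτ0 : 0 < τ := by linarith
  let I : Set (X × ℝ) := {a | a.1 ∈ T ∧ 0 < a.2 ∧ a.2 ≤ δ ∧ b ≤ lpOscillation μ ρ (ball a.1 a.2) f}
  -- Selecting among the `τ`-dilates makes the subfamily admissible. The closed fourfold
  -- enlargements lie in open eightfold ones, whence `c ^ 3`.
  obtain ⟨u, huI, hd, hu⟩ := Vitali.exists_disjoint_subfamily_covering_enlargement_closedBall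
    I Prod.fst (fun a => τ * a.2) (τ * δ) (fun a ha => by gcongr; exact ha.2.2.1) 4 (by norm_num)
  have hd' : u.PairwiseDisjoint fun a => ball a.1 (τ * a.2) :=
    hd.mono fun _ => ball_subset_closedBall
  have hadm : IsAdmissibleFamily τ A u := by
    refine ⟨fun a ha => (huI ha).2.1, fun a ha => ?_, hd'⟩
    refine Subset.trans (ball_subset_ball ?_) (hT a.1 (huI ha).1)
    gcongr
    exact (huI ha).2.2.1
  have hcount : u.Countable := h.countable_of_pairwiseDisjoint
    (fun a ha => mul_pos hτ0 (huI ha).2.1) hd'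
  have hcov : {x ∈ T | ∃ j : ℕ, b ≤ lpOscillation μ ρ (ball x (δ / 2 ^ j)) f} ⊆
      ⋃ a ∈ u, ball a.1 (2 ^ 3 * (τ * a.2)) := by
    rintro x ⟨hx, j, hj⟩
    have hpos : 0 < δ / 2 ^ j := by positivity
    have hle : δ / 2 ^ j ≤ δ := div_le_self hδ.le (one_le_pow₀ one_le_two)
    obtain ⟨a, ha, hxa⟩ := hu (x, δ / 2 ^ j) ⟨hx, hpos, hle, hj⟩
    have hxa' := hxa (mem_closedBall_self (by positivity))
    have h0 : 0 < τ * a.2 := mul_pos hτ0 (huI ha).2.1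
    refine mem_iUnion₂.2 ⟨a, ha, closedBall_subset_ball ?_ hxa'⟩
    linarith
  calc b ^ q * μ {x ∈ T | ∃ j : ℕ, b ≤ lpOscillation μ ρ (ball x (δ / 2 ^ j)) f}
      ≤ b ^ q * ∑' a : u, μ (ball a.1.1 (2 ^ 3 * (τ * a.1.2))) := by
        gcongr
        exact (measure_mono hcov).trans (measure_biUnion_le μ hcount _)
    _ ≤ b ^ q * ∑' a : u, c ^ 3 * μ (ball a.1.1 (τ * a.1.2)) := by
        gcongr with a
        exact h.measure_ball_two_pow_mul _ (mul_pos hτ0 (huI a.2).2.1) 3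
    _ = c ^ 3 * ∑' a : u, b ^ q * μ (ball a.1.1 (τ * a.1.2)) := by
        rw [ENNReal.tsum_mul_left, ENNReal.tsum_mul_left]; ring
    _ ≤ c ^ 3 * ∑' a : u, lpOscillation μ ρ (ball a.1.1 a.1.2) f ^ q *
          μ (ball a.1.1 (τ * a.1.2)) := by
        gcongr with a
        exact (huI a.2).2.2.2
    _ ≤ c ^ 3 * M := by gcongr; exact hJN u hadm

/-- Two steps of size `e ≤ L / 2` from within `L` of `c₀` stay within `2 * L`, so the first exit
index is at least `3`. The gap of three dyadic scales matches the eightfold enlargement in the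
covering argument. -/
theorem exists_powDist_le_and_lt (hρ : 0 < ρ) (hρ' : ρ ≤ 1) {m : ℕ → ℝ} {c₀ : ℝ} {e L : ℝ≥0∞}
    (he : 2 * e ≤ L) (hm : ∀ j, powDist ρ (m (j + 1)) (m j) ≤ e) (h0 : powDist ρ (m 0) c₀ ≤ L)
    (hex : ∃ j, 2 * L < powDist ρ (m j) c₀) :
    ∃ j, powDist ρ (m j) c₀ ≤ 2 * L ∧ 2 * L < powDist ρ (m (j + 3)) c₀ := by
  classical
  have h1 : powDist ρ (m 1) c₀ ≤ e + L :=
    (powDist_triangle hρ hρ' _ (m 0) _).trans (add_le_add (hm 0) h0)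
  have h2 : powDist ρ (m 2) c₀ ≤ e + (e + L) :=
    (powDist_triangle hρ hρ' _ (m 1) _).trans (add_le_add (hm 1) h1)
  have hle : e + (e + L) ≤ 2 * L := by
    calc e + (e + L) = 2 * e + L := by ring
      _ ≤ L + L := by gcongr
      _ = 2 * L := by ring
  have hfind : 3 ≤ Nat.find hex := by
    by_contra hlt
    have hspec := Nat.find_spec hex
    generalize Nat.find hex = k at hlt hspec
    refine absurd hspec (not_lt.2 ?_)
    interval_cases k
    · exact h0.trans (by rw [two_mul]; exact le_add_self)
    · exact (h1.trans le_add_self).trans hle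
    · exact h2.trans hle
  refine ⟨Nat.find hex - 3, not_lt.1 (Nat.find_min hex (by omega)), ?_⟩
  rw [Nat.sub_add_cancel hfind]
  exact Nat.find_spec hex

end

/-! ### The good-`λ` inequality. -/

section

variable {X : Type*} [MetricSpace X] [MeasurableSpace X] [BorelSpace X] {μ : Measure X} {c : ℝ≥0}
  {f : X → ℝ} {ρ : ℝ}

/-- The stopping time argument at a Lebesgue point `x` around which `f` oscillates little. -/
theorem IsDoublingWith.exists_stopping_radius (h : IsDoublingWith μ c)
    (hρ : 0 < ρ) (hρ' : ρ ≤ 1) {x : X} {δ c₀ : ℝ} {L θ N : ℝ≥0∞} (hδ : 0 < δ)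
    (hf : AEMeasurable f (μ.restrict (ball x δ))) (hL : L ≠ 0) (hL' : L ≠ ∞)
    (hθ0 : θ ≠ 0) (hθ : 4 * (c * θ) ≤ 1) (hN : 4 ≤ N)
    (hleb : ∀ ε : ℝ≥0∞, 0 < ε → ∀ᶠ s in 𝓝[>] (0 : ℝ),
      ∫⁻ z in ball x s, powDist ρ (f z) (f x) ∂μ ≤ ε * μ (ball x s))
    (h0 : ∀ a, ∫⁻ y in ball x δ, powDist ρ (f y) a ∂μ ≤ θ * L * μ (ball x δ) →
      powDist ρ a c₀ ≤ L)
    (hosc : ∀ j : ℕ, lpOscillation μ ρ (ball x (δ / 2 ^ j)) f < θ * L)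
    (hx : N * L < powDist ρ (f x) c₀) :
    ∃ u, 0 < u ∧ 8 * u ≤ δ ∧
      μ (ball x (8 * u) ∩ {y | N * L < powDist ρ (f y) c₀}) ≤ θ * μ (ball x (8 * u)) ∧
      μ (ball x u) ≤ 2 * μ (ball x u ∩ {y | L < powDist ρ (f y) c₀}) := by
  have hc1 : (1 : ℝ≥0∞) ≤ c := by exact_mod_cast h.one_le x
  have hθ4 : 4 * θ ≤ 1 := by
    calc 4 * θ = 4 * (1 * θ) := by rw [one_mul]
      _ ≤ 4 * (c * θ) := by gcongr
      _ ≤ 1 := hθ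
  have hθ2 : 2 * θ ≤ 1 := le_trans (by gcongr; norm_num) hθ4
  have hpos : ∀ j : ℕ, 0 < δ / 2 ^ j := fun j => by positivity
  have hle : ∀ j : ℕ, δ / 2 ^ j ≤ δ := fun j => div_le_self hδ.le (one_le_pow₀ one_le_two)
  have hμ0 : ∀ j : ℕ, μ (ball x (δ / 2 ^ j)) ≠ 0 := fun j => (h.ball_pos x _ (hpos j)).ne'
  have hμ1 : ∀ j : ℕ, μ (ball x (δ / 2 ^ j)) ≠ ∞ := fun j => (h.ball_lt_top x _ (hpos j)).ne
  have hfj : ∀ j : ℕ, AEMeasurable f (μ.restrict (ball x (δ / 2 ^ j))) := fun j =>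
    hf.mono_set (ball_subset_ball (hle j))
  choose m hm using fun j => exists_lintegral_powDist_le (hμ0 j) (hμ1 j) (hosc j)
  have hstep : ∀ j, powDist ρ (m (j + 1)) (m j) ≤ θ * L + c * (θ * L) := by
    intro j
    have heq : δ / 2 ^ j = 2 ^ 1 * (δ / 2 ^ (j + 1)) := by rw [pow_one, pow_succ]; field_simp
    refine powDist_le_of_lintegral_le hρ hρ' (hfj (j + 1)) (hμ0 _) (hμ1 _)
      (t := ball x (δ / 2 ^ j)) (ball_subset_ball ?_) ?_ (hm (j + 1)) (hm j)
    · rw [heq]; linarith [hpos (j + 1)]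
    · simpa using h.measure_le_of_subset x (hpos (j + 1)) (subset_refl (ball x (δ / 2 ^ j)))
        (k := 1) heq.le
  have he : 2 * (θ * L + c * (θ * L)) ≤ L := by
    calc 2 * (θ * L + c * (θ * L)) ≤ 2 * (c * (θ * L) + c * (θ * L)) := by
          gcongr 2 * (?_ + _)
          exact le_mul_of_one_le_left' hc1
      _ = 4 * (c * θ) * L := by ring
      _ ≤ 1 * L := by gcongr
      _ = L := one_mul L
  have hm0 : powDist ρ (m 0) c₀ ≤ L := h0 _ (by simpa using hm 0)
  -- At a Lebesgue point `m j` is eventually within `L` of `f x`, which is farther than `4 * L` from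
  -- `c₀`.
  have hex : ∃ j, 2 * L < powDist ρ (m j) c₀ := by
    have htend : Tendsto (fun j : ℕ => δ / 2 ^ j) atTop (𝓝[>] (0 : ℝ)) := by
      refine tendsto_nhdsWithin_iff.2 ⟨?_, Eventually.of_forall hpos⟩
      simpa [div_eq_mul_inv] using
        (tendsto_pow_atTop_nhds_zero_of_lt_one (r := (2 : ℝ)⁻¹) (by norm_num)
          (by norm_num)).const_mul δ
    obtain ⟨j, hj⟩ := (htend.eventually
      (hleb (θ * L) (pos_iff_ne_zero.2 (mul_ne_zero hθ0 hL)))).exists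
    have hfm : powDist ρ (f x) (m j) ≤ L := by
      refine (powDist_le_of_lintegral_le hρ hρ' (hfj j) (hμ0 j) (hμ1 j) subset_rfl
        (κ := 1) (by simp) hj (hm j)).trans ?_
      calc θ * L + 1 * (θ * L) = 2 * θ * L := by ring
        _ ≤ 1 * L := by gcongr
        _ = L := one_mul L
    refine ⟨j, ?_⟩
    by_contra hlt
    refine absurd hx (not_lt.2 ?_)
    calc powDist ρ (f x) c₀ ≤ powDist ρ (f x) (m j) + powDist ρ (m j) c₀ :=
          powDist_triangle hρ hρ' _ _ _
      _ ≤ L + 2 * L := add_le_add hfm (not_lt.1 hlt)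
      _ = 3 * L := by ring
      _ ≤ N * L := by gcongr; exact le_trans (by norm_num) hN
  obtain ⟨j, hj, hj3⟩ := exists_powDist_le_and_lt hρ hρ' he hstep hm0 hex
  have h8 : 8 * (δ / 2 ^ (j + 3)) = δ / 2 ^ j := by rw [pow_add]; field_simp; norm_num
  refine ⟨δ / 2 ^ (j + 3), hpos _, by rw [h8]; exact hle j, ?_, ?_⟩
  -- On the large ball `m j` is within `2 * L` of `c₀`, so the level set of `N * L ≥ 3 * L` is
  -- `L`-far from `m j` and Chebyshev applies.
  · rw [h8]
    refine le_trans (measure_mono (inter_subset_inter_right _ fun y hy => ?_))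
      (measure_powDist_le (hfj j) hL hL' (hm j) measurableSet_ball)
    rw [mem_ofPred_eq] at hy ⊢
    by_contra hlt
    refine absurd hy (not_lt.2 ?_)
    calc powDist ρ (f y) c₀ ≤ powDist ρ (f y) (m j) + powDist ρ (m j) c₀ :=
          powDist_triangle hρ hρ' _ _ _
      _ ≤ L + 2 * L := add_le_add (not_le.1 hlt).le hj
      _ = 3 * L := by ring
      _ ≤ N * L := by gcongr; exact le_trans (by norm_num) hN
  · set B := ball x (δ / 2 ^ (j + 3))
    -- On the small ball `m (j + 3)` is farther than `2 * L` from `c₀`, so values within `L` of `c₀`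
    -- are `L`-far from it. They fill at most half of `B` because `2 * θ ≤ 1`.
    have hdiff : μ (B \ {y | L < powDist ρ (f y) c₀}) ≤ θ * μ B := by
      refine le_trans (measure_mono
        (t := B ∩ {y | L ≤ powDist ρ (f y) (m (j + 3))}) fun y hy => ⟨hy.1, ?_⟩)
        (measure_powDist_le (hfj (j + 3)) hL hL' (hm (j + 3)) measurableSet_ball)
      have hy2 : powDist ρ (f y) c₀ ≤ L := not_lt.1 hy.2
      rw [mem_ofPred_eq]
      by_contra hlt
      refine absurd hj3 (not_lt.2 ?_)
      calc powDist ρ (m (j + 3)) c₀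
          ≤ powDist ρ (m (j + 3)) (f y) + powDist ρ (f y) c₀ := powDist_triangle hρ hρ' _ _ _
        _ ≤ L + L := add_le_add (by rw [powDist_comm]; exact (not_le.1 hlt).le) hy2
        _ = 2 * L := by ring
    have hsum : μ B + μ B ≤ 2 * μ (B ∩ {y | L < powDist ρ (f y) c₀}) + μ B := by
      calc μ B + μ B = 2 * μ B := by ring
        _ ≤ 2 * (μ (B ∩ {y | L < powDist ρ (f y) c₀})
              + μ (B \ {y | L < powDist ρ (f y) c₀})) := by
            gcongr; exact measure_le_inter_add_sdiff μ _ _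
        _ ≤ 2 * (μ (B ∩ {y | L < powDist ρ (f y) c₀}) + θ * μ B) := by gcongr
        _ = 2 * μ (B ∩ {y | L < powDist ρ (f y) c₀}) + 2 * θ * μ B := by ring
        _ ≤ 2 * μ (B ∩ {y | L < powDist ρ (f y) c₀}) + 1 * μ B := by gcongr
        _ = _ := by rw [one_mul]
    exact (ENNReal.add_le_add_iff_right (hμ1 _)).1 hsum

/-- A good-`λ` inequality between the level sets of `|f - c₀| ^ ρ` on two concentric balls. -/
theorem IsDoublingWith.measure_levelSet_le (h : IsDoublingWith μ c)
    (hρ : 0 < ρ) (hρ' : ρ ≤ 1) {x₀ : X} {s t δ c₀ : ℝ} {L θ N : ℝ≥0∞} (hδ : 0 < δ)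
    (hst : s + δ ≤ t) (hf : AEMeasurable f (μ.restrict (ball x₀ t))) (hL : L ≠ 0) (hL' : L ≠ ∞)
    (hθ0 : θ ≠ 0) (hθ : 4 * (c * θ) ≤ 1) (hN : 4 ≤ N)
    (hleb : ∀ᵐ x ∂μ, x ∈ ball x₀ t → ∀ ε : ℝ≥0∞, 0 < ε → ∀ᶠ s in 𝓝[>] (0 : ℝ),
      ∫⁻ z in ball x s, powDist ρ (f z) (f x) ∂μ ≤ ε * μ (ball x s))
    (h0 : ∀ x ∈ ball x₀ s, ∀ a,
      ∫⁻ y in ball x δ, powDist ρ (f y) a ∂μ ≤ θ * L * μ (ball x δ) → powDist ρ a c₀ ≤ L) :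
    μ (ball x₀ s ∩ {y | N * L < powDist ρ (f y) c₀}) ≤
      μ {x ∈ ball x₀ s | ∃ j : ℕ, θ * L ≤ lpOscillation μ ρ (ball x (δ / 2 ^ j)) f} +
      2 * c ^ 3 * θ * μ (ball x₀ t ∩ {y | L < powDist ρ (f y) c₀}) := by
  set bad := {x ∈ ball x₀ s | ∃ j : ℕ, θ * L ≤ lpOscillation μ ρ (ball x (δ / 2 ^ j)) f}
  set leb := {x | x ∈ ball x₀ t → ∀ ε : ℝ≥0∞, 0 < ε → ∀ᶠ s in 𝓝[>] (0 : ℝ),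
      ∫⁻ z in ball x s, powDist ρ (f z) (f x) ∂μ ≤ ε * μ (ball x s)}
  set E := {y | L < powDist ρ (f y) c₀}
  set F := {y | N * L < powDist ρ (f y) c₀}
  set good := (ball x₀ s ∩ F) \ bad ∩ leb
  have hsubt : ∀ x ∈ ball x₀ s, ball x δ ⊆ ball x₀ t := fun x hx =>
    ball_subset_ball' (by rw [mem_ball] at hx; linarith)
  have hex_radius : ∀ x : good, ∃ u, 0 < u ∧ 8 * u ≤ δ ∧
      μ (ball x.1 (8 * u) ∩ F) ≤ θ * μ (ball x.1 (8 * u)) ∧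
      μ (ball x.1 u) ≤ 2 * μ (ball x.1 u ∩ E) := by
    rintro ⟨x, ⟨⟨hxs, hxF⟩, hxb⟩, hxl⟩
    refine h.exists_stopping_radius hρ hρ' hδ (hf.mono_set (hsubt x hxs)) hL hL' hθ0 hθ hN
      (hxl (hsubt x hxs (mem_ball_self hδ))) (h0 x hxs) (fun j => ?_) hxF
    by_contra hj
    exact hxb ⟨hxs, j, not_lt.1 hj⟩
  choose u hu0 huδ huF huE using hex_radius
  -- The disjoint small balls are charged to `E`; their eightfold enlargements cover `good` and
  -- contain little of `F`.
  obtain ⟨v, -, hd, hv⟩ := Vitali.exists_disjoint_subfamily_covering_enlargement_closedBall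
    (univ : Set good) Subtype.val u δ (fun x _ => by linarith [hu0 x, huδ x]) 4 (by norm_num)
  have hd' : v.PairwiseDisjoint fun x => ball x.1 (u x) := hd.mono fun _ => ball_subset_closedBall
  have hcount : v.Countable := h.countable_of_pairwiseDisjoint (fun x _ => hu0 x) hd'
  have hcov : good ⊆ ⋃ x ∈ v, ball x.1 (8 * u x) ∩ F := by
    intro y hy
    obtain ⟨x, hx, hyx⟩ := hv ⟨y, hy⟩ (mem_univ _)
    refine mem_iUnion₂.2 ⟨x, hx, ?_, hy.1.1.2⟩
    exact closedBall_subset_ball (by linarith [hu0 x]) (hyx (mem_closedBall_self (hu0 _).le))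
  have hEv : ∑' x : v, μ (ball x.1.1 (u x.1) ∩ E) ≤ μ (ball x₀ t ∩ E) := by
    have hunion : ⋃ x ∈ v, ball x.1 (u x) ⊆ ball x₀ t := iUnion₂_subset fun x _ =>
      (ball_subset_ball (by linarith [hu0 x, huδ x])).trans (hsubt x.1 x.2.1.1.1)
    calc ∑' x : v, μ (ball x.1.1 (u x.1) ∩ E)
        = ∑' x : v, μ.restrict E (ball x.1.1 (u x.1)) := by
          simp_rw [Measure.restrict_apply measurableSet_ball]
      _ = μ.restrict E (⋃ x ∈ v, ball x.1 (u x)) :=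
          (measure_biUnion hcount hd' fun _ _ => measurableSet_ball).symm
      _ ≤ μ.restrict E (ball x₀ t) := measure_mono hunion
      _ = μ (ball x₀ t ∩ E) := Measure.restrict_apply measurableSet_ball
  have hgoodle : μ good ≤ 2 * c ^ 3 * θ * μ (ball x₀ t ∩ E) := by
    calc μ good ≤ ∑' x : v, μ (ball x.1.1 (8 * u x.1) ∩ F) :=
          (measure_mono hcov).trans (measure_biUnion_le μ hcount _)
      _ ≤ ∑' x : v, 2 * c ^ 3 * θ * μ (ball x.1.1 (u x.1) ∩ E) := by
          gcongr with x
          calc μ (ball x.1.1 (8 * u x.1) ∩ F) ≤ θ * μ (ball x.1.1 (8 * u x.1)) := huF x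
            _ ≤ θ * (c ^ 3 * μ (ball x.1.1 (u x.1))) := by
                gcongr
                exact h.measure_le_of_subset _ (hu0 _) subset_rfl (by norm_num)
            _ ≤ θ * (c ^ 3 * (2 * μ (ball x.1.1 (u x.1) ∩ E))) := by gcongr; exact huE x
            _ = _ := by ring
      _ = 2 * c ^ 3 * θ * ∑' x : v, μ (ball x.1.1 (u x.1) ∩ E) := ENNReal.tsum_mul_left
      _ ≤ _ := by gcongr
  have hlebc : μ lebᶜ = 0 := hleb
  have hcover : ball x₀ s ∩ F ⊆ bad ∪ good ∪ lebᶜ := by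
    intro y hy
    by_cases hb : y ∈ bad
    · exact Or.inl (Or.inl hb)
    · by_cases hl : y ∈ leb
      · exact Or.inl (Or.inr ⟨⟨hy, hb⟩, hl⟩)
      · exact Or.inr hl
  calc μ (ball x₀ s ∩ F) ≤ μ bad + μ good + μ lebᶜ :=
        (measure_mono hcover).trans ((measure_union_le _ _).trans
          (by gcongr; exact measure_union_le _ _))
    _ = μ bad + μ good := by rw [hlebc, add_zero]
    _ ≤ _ := by gcongr

end

/-! ### Iteration of the good-`λ` inequality. -/

section

variable {X : Type*} [MetricSpace X] [MeasurableSpace X] [BorelSpace X] {μ : Measure X} {c : ℝ≥0}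
  {f : X → ℝ} {ρ : ℝ}

/-- Decay of the level sets of `|f - c₀| ^ ρ` along a geometric sequence of levels, on balls that
shrink to `ball x₀ r`. -/
theorem IsDoublingWith.rpow_mul_measure_levelSet_pow_le (h : IsDoublingWith μ c)
    (hρ : 0 < ρ) (hρ' : ρ ≤ 1) {τ η q : ℝ} (hτ : 1 ≤ τ) (hη : 0 < η) (hq : 0 < q)
    {x₀ : X} {r c₀ : ℝ} (hr : 0 < r) {k : ℕ} (hk : 4 * (1 + η) ≤ 2 ^ k * η)
    (hf : AEMeasurable f (μ.restrict (ball x₀ ((1 + η) * r))))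
    {κ θ N D : ℝ≥0∞} (hκ : κ ≠ 0) (hκ' : κ ≠ ∞) (hN : 4 ≤ N) (hcN : c ≤ N) (hN' : N ≠ ∞)
    (hθ0 : θ ≠ 0) (hθ : 4 * (c ^ 3 * N ^ q * θ) ≤ 1)
    (hD : 2 * (N ^ q * (c ^ 3 * (θ ^ q)⁻¹)) ≤ D) (hD' : (2 * c ^ k) ^ q ≤ D)
    (hleb : ∀ᵐ x ∂μ, x ∈ ball x₀ ((1 + η) * r) → ∀ ε : ℝ≥0∞, 0 < ε → ∀ᶠ s in 𝓝[>] (0 : ℝ),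
      ∫⁻ z in ball x s, powDist ρ (f z) (f x) ∂μ ≤ ε * μ (ball x s))
    (hJN : ∀ S, IsAdmissibleFamily τ (ball x₀ (τ * ((1 + η) * r))) S →
      ∑' b : S, lpOscillation μ ρ (ball b.1.1 b.1.2) f ^ q * μ (ball b.1.1 (τ * b.1.2)) ≤
        κ ^ q * μ (ball x₀ (τ * ((1 + η) * r))))
    (hc₀ : ∫⁻ y in ball x₀ ((1 + η) * r), powDist ρ (f y) c₀ ∂μ ≤
      κ * μ (ball x₀ ((1 + η) * r))) (i : ℕ) :
    (2 * c ^ k * κ * N ^ i) ^ q *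
      μ (ball x₀ (r * (1 + η / 2 ^ i)) ∩ {y | 2 * c ^ k * κ * N ^ i < powDist ρ (f y) c₀}) ≤
      D * (κ ^ q * μ (ball x₀ (τ * ((1 + η) * r)))) := by
  have hc1 : (1 : ℝ≥0∞) ≤ c := by exact_mod_cast h.one_le x₀
  have hc0 : (c : ℝ≥0∞) ≠ 0 := (zero_lt_one.trans_le hc1).ne'
  have hNq : 1 ≤ N ^ q := ENNReal.one_le_rpow (le_trans (by norm_num) hN) hq
  have hrle : ∀ i : ℕ, r * (1 + η / 2 ^ i) ≤ (1 + η) * r := fun i => by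
    have : η / 2 ^ i ≤ η := div_le_self hη.le (one_le_pow₀ one_le_two)
    rw [mul_comm]; gcongr
  have hhat : (1 + η) * r ≤ τ * ((1 + η) * r) := le_mul_of_one_le_left (by positivity) hτ
  set A := ball x₀ (τ * ((1 + η) * r))
  have h4cθ : 4 * (c * θ) ≤ 1 := by
    refine le_trans ?_ hθ
    calc 4 * (c * θ) = 4 * (c ^ 1 * 1 * θ) := by rw [pow_one, mul_one]
      _ ≤ 4 * (c ^ 3 * N ^ q * θ) := by gcongr; norm_num
  have h2θ : 2 * θ ≤ 1 := by
    refine le_trans ?_ h4cθ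
    calc 2 * θ = 2 * (1 * θ) := by rw [one_mul]
      _ ≤ 4 * (c * θ) := by gcongr; norm_num
  induction i with
  | zero =>
    calc _ ≤ (2 * c ^ k * κ * N ^ 0) ^ q * μ A := by
          gcongr
          exact inter_subset_left.trans (ball_subset_ball ((hrle 0).trans hhat))
      _ = (2 * c ^ k) ^ q * (κ ^ q * μ A) := by
          rw [pow_zero, mul_one, ENNReal.mul_rpow_of_nonneg _ _ hq.le, mul_assoc]
      _ ≤ _ := by gcongr
  | succ i ih =>
    set L := 2 * c ^ k * κ * N ^ i with hLdef
    have hLsucc : 2 * c ^ k * κ * N ^ (i + 1) = N * L := by rw [hLdef]; ring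
    have hN0 : N ≠ 0 := (lt_of_lt_of_le (by norm_num) hN).ne'
    have hL : L ≠ 0 := mul_ne_zero (mul_ne_zero (mul_ne_zero two_ne_zero (pow_ne_zero _ hc0)) hκ)
      (pow_ne_zero _ hN0)
    have hL' : L ≠ ∞ := ENNReal.mul_ne_top (ENNReal.mul_ne_top (ENNReal.mul_ne_top
      ENNReal.ofNat_ne_top (ENNReal.pow_ne_top ENNReal.coe_ne_top)) hκ') (ENNReal.pow_ne_top hN')
    set δ := r * η / 2 ^ (i + 1) with hδdef
    have hδ : 0 < δ := by positivity
    set s := r * (1 + η / 2 ^ (i + 1)) with hsdef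
    have hs0 : 0 < s := by positivity
    have hst : s + δ = r * (1 + η / 2 ^ i) := by
      rw [hsdef, hδdef, pow_succ]; field_simp; ring
    have hst' : s + δ ≤ (1 + η) * r := hst.trans_le (hrle i)
    have hsub : ∀ x ∈ ball x₀ s, ball x δ ⊆ ball x₀ ((1 + η) * r) := fun x hx =>
      ball_subset_ball' (by rw [mem_ball] at hx; linarith)
    -- Comparing `ball x δ` with the fixed enlarged ball costs `c ^ (k + i)`, as `δ` shrinks like `2
    -- ^ (-i)`. The growing factor `c ^ i` is absorbed by `N ^ i` in `L`.
    have h0 : ∀ x ∈ ball x₀ s, ∀ a,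
        ∫⁻ y in ball x δ, powDist ρ (f y) a ∂μ ≤ θ * L * μ (ball x δ) → powDist ρ a c₀ ≤ L := by
      intro x hx a ha
      have hmeas : μ (ball x₀ ((1 + η) * r)) ≤ c ^ (k + i) * μ (ball x δ) := by
        refine h.measure_le_of_subset x hδ (R := 2 * ((1 + η) * r)) (ball_subset_ball' ?_) ?_
        · rw [mem_ball, dist_comm] at hx; linarith
        · have : 2 ^ (k + i) * δ = r * (2 ^ k * η) / 2 := by
            rw [hδdef, pow_add, pow_succ]; field_simp
          rw [this]
          nlinarith
      have hac := powDist_le_of_lintegral_le hρ hρ' (hf.mono_set (hsub x hx))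
        (h.ball_pos x δ hδ).ne' (h.ball_lt_top x δ hδ).ne (hsub x hx) hmeas ha hc₀
      rw [← ENNReal.mul_le_mul_iff_right two_ne_zero ENNReal.ofNat_ne_top]
      calc 2 * powDist ρ a c₀ ≤ 2 * (θ * L + c ^ (k + i) * κ) := by gcongr
        _ = 2 * θ * L + 2 * c ^ k * κ * c ^ i := by ring
        _ ≤ 1 * L + 2 * c ^ k * κ * N ^ i := by gcongr
        _ = 2 * L := by rw [← hLdef]; ring
    have hgood := h.measure_levelSet_le hρ hρ' hδ hst.le
      (hf.mono_set (ball_subset_ball (hrle i))) hL hL' hθ0 h4cθ hN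
      (hleb.mono fun x hx hxb => hx (ball_subset_ball (hrle i) hxb)) h0
    have hbad := h.measure_lpOscillation_ge_le (T := ball x₀ s) (b := θ * L) hτ hq hδ hJN
      (fun x hx => ball_subset_ball' (by
        rw [mem_ball] at hx
        nlinarith))
    set bad := {x ∈ ball x₀ s | ∃ j : ℕ, θ * L ≤ lpOscillation μ ρ (ball x (δ / 2 ^ j)) f}
    have hθ' : θ ≠ ∞ := by
      rintro rfl
      simp at h2θ
    have hθq0 : θ ^ q ≠ 0 := by simp [hθ0, hq.le]
    have hθq1 : θ ^ q ≠ ∞ := ENNReal.rpow_ne_top_of_nonneg hq.le hθ'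
    set Z := κ ^ q * μ A
    have hbad' : L ^ q * μ bad ≤ (θ ^ q)⁻¹ * (c ^ 3 * Z) := by
      rw [ENNReal.mul_rpow_of_nonneg _ _ hq.le, mul_assoc] at hbad
      calc L ^ q * μ bad = (θ ^ q)⁻¹ * (θ ^ q * (L ^ q * μ bad)) := by
            rw [← mul_assoc (θ ^ q)⁻¹, ENNReal.inv_mul_cancel hθq0 hθq1, one_mul]
        _ ≤ _ := by gcongr
    rw [hLsucc, ← ENNReal.mul_le_mul_iff_right two_ne_zero ENNReal.ofNat_ne_top,
      ENNReal.mul_rpow_of_nonneg _ _ hq.le]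
    rw [← hst] at ih
    -- After doubling, `hD` bounds the bad set by one copy of `D * Z`, and `hθ` with the induction
    -- hypothesis bounds the good part by another.
    calc 2 * (N ^ q * L ^ q * μ (ball x₀ s ∩ {y | N * L < powDist ρ (f y) c₀}))
        ≤ 2 * (N ^ q * L ^ q * (μ bad +
            2 * c ^ 3 * θ * μ (ball x₀ (s + δ) ∩ {y | L < powDist ρ (f y) c₀}))) := by
          rw [hst]; gcongr
      _ = 2 * N ^ q * (L ^ q * μ bad) + 4 * (c ^ 3 * N ^ q * θ) *
            (L ^ q * μ (ball x₀ (s + δ) ∩ {y | L < powDist ρ (f y) c₀})) := by ring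
      _ ≤ 2 * N ^ q * ((θ ^ q)⁻¹ * (c ^ 3 * Z)) + 1 * (D * Z) := by gcongr
      _ = 2 * (N ^ q * (c ^ 3 * (θ ^ q)⁻¹)) * Z + D * Z := by ring
      _ ≤ D * Z + D * Z := by gcongr
      _ = 2 * (D * Z) := by ring

end

/-! ### From geometric levels to all levels. -/

theorem exists_pow_le_lt {L₀ L N : ℝ≥0∞} (h0 : L₀ ≠ 0) (h0' : L₀ ≠ ∞) (hN : 2 ≤ N) (hL : L ≠ ∞)
    (h : L₀ ≤ L) : ∃ i : ℕ, L₀ * N ^ i ≤ L ∧ L < N * (L₀ * N ^ i) := by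
  classical
  have hex : ∃ n : ℕ, L < L₀ * N ^ n := by
    obtain ⟨n, hn⟩ := ENNReal.exists_nat_gt (ENNReal.div_ne_top hL h0)
    refine ⟨n, ?_⟩
    rw [mul_comm, ← ENNReal.div_lt_iff (Or.inl h0) (Or.inl h0')]
    calc L / L₀ < n := hn
      _ ≤ 2 ^ n := by exact_mod_cast Nat.lt_two_pow_self.le
      _ ≤ N ^ n := by gcongr
  have hpos : Nat.find hex ≠ 0 := fun hz => by
    have := Nat.find_spec hex
    rw [hz, pow_zero, mul_one] at this
    exact absurd h (not_le.2 this)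
  obtain ⟨i, hi⟩ := Nat.exists_eq_succ_of_ne_zero hpos
  refine ⟨i, not_lt.1 (Nat.find_min hex (by omega)), ?_⟩
  have := Nat.find_spec hex
  rw [hi, Nat.succ_eq_add_one] at this
  calc L < L₀ * N ^ (i + 1) := this
    _ = _ := by ring

theorem rpow_mul_measure_le_of_geometric {X : Type*} [MeasurableSpace X] {ν : Measure X} {g : X → ℝ≥0∞} {L₀ N M : ℝ≥0∞} {q : ℝ}
    (hq : 0 < q) (h0 : L₀ ≠ 0) (h0' : L₀ ≠ ∞) (hN : 2 ≤ N) (h0M : L₀ ^ q * ν univ ≤ M)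
    (h : ∀ i : ℕ, (L₀ * N ^ i) ^ q * ν {y | L₀ * N ^ i < g y} ≤ M) (L : ℝ≥0∞) :
    L ^ q * ν {y | L < g y} ≤ N ^ q * M := by
  have hNq : 1 ≤ N ^ q := ENNReal.one_le_rpow (le_trans (by norm_num) hN) hq
  rcases eq_or_ne L ∞ with rfl | hL
  · simp
  rcases le_total L L₀ with hle | hle
  · calc L ^ q * ν {y | L < g y} ≤ L₀ ^ q * ν univ := by gcongr; exact subset_univ _
      _ ≤ 1 * M := by rwa [one_mul]
      _ ≤ N ^ q * M := by gcongr
  · obtain ⟨i, hi, hi'⟩ := exists_pow_le_lt h0 h0' hN hL hle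
    calc L ^ q * ν {y | L < g y} ≤ (N * (L₀ * N ^ i)) ^ q * ν {y | L₀ * N ^ i < g y} := by
          gcongr
      _ = N ^ q * ((L₀ * N ^ i) ^ q * ν {y | L₀ * N ^ i < g y}) := by
          rw [ENNReal.mul_rpow_of_nonneg _ _ hq.le, mul_assoc]
      _ ≤ _ := by gcongr; exact h i

/-- The norm of the embedding of normalized weak `L^p` into `L^1`, for a weak quasinorm whose
`p`-th power is at most `W`. -/
noncomputable def weakToStrongConst (p : ℝ) (W : ℝ≥0∞) : ℝ≥0∞ :=
  1 + 2 * W * (1 - 2 ^ (1 - p))⁻¹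

theorem weakToStrongConst_ne_top {p : ℝ} (hp : 1 < p) {W : ℝ≥0∞} (hW : W ≠ ∞) :
    weakToStrongConst p W ≠ ∞ := by
  have h : (2 : ℝ≥0∞) ^ (1 - p) < 1 := ENNReal.rpow_lt_one_of_one_lt_of_neg (by norm_num)
    (by linarith)
  exact ENNReal.add_ne_top.2 ⟨ENNReal.one_ne_top, ENNReal.mul_ne_top
    (ENNReal.mul_ne_top ENNReal.ofNat_ne_top hW) (ENNReal.inv_ne_top.2 (tsub_pos_of_lt h).ne')⟩

/-! ### From weak type bounds to integrability, and replacing the constant by the mean. -/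

section

variable {X : Type*} [MeasurableSpace X] {ν : Measure X} {p : ℝ} {K W : ℝ≥0∞}

/-- Dyadic layer cake above height `K`: the weak bound makes the layers a geometric series of ratio
`2 ^ (1 - p)`. -/
theorem lintegral_le_of_weak_type (hK : K ≠ 0) (hK' : K ≠ ∞)
    {g : X → ℝ≥0∞} (hg : AEMeasurable g ν) (hgtop : ∀ x, g x ≠ ∞)
    (h : ∀ t, t ^ p * ν {y | t < g y} ≤ W * K ^ p * ν univ) :
    ∫⁻ x, g x ∂ν ≤ weakToStrongConst p W * K * ν univ := by
  have hpt : ∀ x, g x ≤ K + ∑' i : ℕ, {y | K * 2 ^ i < g y}.indicator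
      (fun _ => 2 * (K * 2 ^ i)) x := by
    intro x
    rcases le_total (g x) K with hx | hx
    · exact hx.trans le_self_add
    · obtain ⟨i, hi, hi'⟩ := exists_pow_le_lt (N := 2) hK hK' le_rfl (hgtop x) hx
      rcases hi.lt_or_eq with hlt | heq
      · refine le_trans ?_ le_add_self
        refine le_trans ?_ (ENNReal.le_tsum i)
        rw [indicator_of_mem (by exact hlt)]
        exact hi'.le
      -- The level sets are strict, so when `g x` equals a dyadic level the term of the previous
      -- level is the one that dominates it.
      · rcases i with _ | i
        · rw [← heq]; simp
        · refine le_trans ?_ le_add_self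
          refine le_trans ?_ (ENNReal.le_tsum i)
          have hlt : K * 2 ^ i < g x := by
            rw [← heq]
            refine ENNReal.mul_lt_mul_right hK hK' ?_
            exact_mod_cast Nat.pow_lt_pow_right one_lt_two (Nat.lt_succ_self i)
          rw [indicator_of_mem (by exact hlt), ← heq]
          exact le_of_eq (by ring)
  have hnull : ∀ i : ℕ, NullMeasurableSet {y | K * 2 ^ i < g y} ν := fun i =>
    nullMeasurableSet_lt aemeasurable_const hg
  have hterm : ∀ i : ℕ, 2 * (K * 2 ^ i) * ν {y | K * 2 ^ i < g y} ≤
      2 * W * K * ν univ * (2 ^ (1 - p)) ^ i := by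
    intro i
    set t := K * 2 ^ i with ht
    have h20 : (2 : ℝ≥0∞) ^ i ≠ 0 := pow_ne_zero _ two_ne_zero
    have h2t : (2 : ℝ≥0∞) ^ i ≠ ∞ := ENNReal.pow_ne_top ENNReal.ofNat_ne_top
    have ht0 : t ≠ 0 := mul_ne_zero hK h20
    have ht1 : t ≠ ∞ := ENNReal.mul_ne_top hK' h2t
    calc 2 * t * ν {y | t < g y} = 2 * t ^ (1 - p) * (t ^ p * ν {y | t < g y}) := by
          rw [mul_assoc 2 (t ^ (1 - p)), ← mul_assoc (t ^ (1 - p)),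
            ← ENNReal.rpow_add _ _ ht0 ht1]
          simp [mul_assoc]
      _ ≤ 2 * t ^ (1 - p) * (W * K ^ p * ν univ) := by gcongr 2 * _ * ?_; exact h t
      _ = 2 * W * (K ^ (1 - p) * K ^ p) * ν univ * (2 ^ i) ^ (1 - p) := by
          rw [ht, ENNReal.mul_rpow_of_ne_zero hK h20]; ring
      _ = 2 * W * K * ν univ * (2 ^ (1 - p)) ^ i := by
          rw [← ENNReal.rpow_add _ _ hK hK', ← ENNReal.rpow_natCast, ← ENNReal.rpow_natCast,
            ← ENNReal.rpow_mul, ← ENNReal.rpow_mul, mul_comm (i : ℝ)]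
          simp
  calc ∫⁻ x, g x ∂ν
      ≤ ∫⁻ x, K + ∑' i : ℕ, {y | K * 2 ^ i < g y}.indicator
          (fun _ => 2 * (K * 2 ^ i)) x ∂ν := lintegral_mono hpt
    _ = K * ν univ + ∑' i : ℕ, 2 * (K * 2 ^ i) * ν {y | K * 2 ^ i < g y} := by
        rw [lintegral_add_left measurable_const, lintegral_const, lintegral_tsum]
        · congr 1
          refine tsum_congr fun i => ?_
          rw [lintegral_indicator_const₀ (hnull i)]
        · exact fun i => aemeasurable_const.indicator₀ (hnull i)
    _ ≤ K * ν univ + ∑' i : ℕ, 2 * W * K * ν univ * (2 ^ (1 - p)) ^ i := by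
        gcongr _ + ∑' i, ?_; exact hterm _
    _ = weakToStrongConst p W * K * ν univ := by
        rw [ENNReal.tsum_mul_left, ENNReal.tsum_geometric, weakToStrongConst]; ring

theorem integrable_and_enorm_average_sub_le (hp : 1 < p) (hW : W ≠ ∞) (hK : K ≠ 0) (hK' : K ≠ ∞)
    [IsFiniteMeasure ν] [NeZero ν] {f : X → ℝ} (hf : AEStronglyMeasurable f ν) (c₀ : ℝ)
    (h : ∀ t, t ^ p * ν {y | t < ‖f y - c₀‖ₑ} ≤ W * K ^ p * ν univ) :
    Integrable f ν ∧ ‖(⨍ x, f x ∂ν) - c₀‖ₑ ≤ weakToStrongConst p W * K := by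
  have hle : ∫⁻ x, ‖f x - c₀‖ₑ ∂ν ≤ weakToStrongConst p W * K * ν univ :=
    lintegral_le_of_weak_type hK hK' (hf.aemeasurable.sub_const c₀).enorm
      (fun _ => enorm_ne_top) h
  have hsub : Integrable (fun x => f x - c₀) ν :=
    ⟨hf.sub aestronglyMeasurable_const, hle.trans_lt (ENNReal.mul_lt_top (ENNReal.mul_lt_top
      (weakToStrongConst_ne_top hp hW).lt_top hK'.lt_top) (measure_lt_top _ _))⟩
  have hfi : Integrable f ν := 
    (hsub.add (integrable_const c₀)).congr (ae_of_all _ fun x => by simp)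
  refine ⟨hfi, ?_⟩
  have heq : (⨍ x, f x ∂ν) - c₀ = ⨍ x, (f x - c₀) ∂ν := by
    have hu : ν.real univ ≠ 0 := by
      simp [measureReal_def, ENNReal.toReal_eq_zero_iff, NeZero.ne ν]
    rw [average_eq, average_eq, integral_sub hfi (integrable_const c₀), integral_const, smul_sub,
      smul_smul, inv_mul_cancel₀ hu, one_smul]
  have hu0 : ν univ ≠ 0 := by simp [NeZero.ne ν]
  calc ‖(⨍ x, f x ∂ν) - c₀‖ₑ ≤ ⨍⁻ x, ‖f x - c₀‖ₑ ∂ν := by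
        rw [heq]; exact enorm_integral_le_lintegral_enorm _
    _ ≤ weakToStrongConst p W * K := by
        rw [laverage_eq]
        exact ENNReal.div_le_of_le_mul hle

/-- For `t ≤ 2 * V * K` the measure ratio is at most `1`. For larger `t` the shift from `c₀` to `a`
costs at most `t / 2`, and the weak bound is used at `t / 2`. -/
theorem weakLpNorm_sub_le (hp0 : 0 < p) {μ : Measure X} {B : Set X} {f : X → ℝ} {c₀ a : ℝ} {V : ℝ≥0∞}
    (ha : ‖a - c₀‖ₑ ≤ V * K)
    (h : ∀ t, t ^ p * μ {y ∈ B | t < ‖f y - c₀‖ₑ} ≤ W * K ^ p * μ B) :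
    weakLpNorm μ p B (fun y => f y - a) ≤ (2 * V + 2 * W ^ (1 / p)) * K := by
  refine iSup_le fun t => ?_
  rcases le_total (t : ℝ≥0∞) (2 * V * K) with ht | ht
  · calc (t : ℝ≥0∞) * (μ {x ∈ B | (t : ℝ≥0∞) < ‖f x - a‖ₑ} / μ B) ^ (1 / p)
        ≤ 2 * V * K * 1 := by
          gcongr
          refine ENNReal.rpow_le_one (ENNReal.div_le_of_le_mul ?_) (by positivity)
          rw [one_mul]
          exact measure_mono fun x hx => hx.1
      _ ≤ (2 * V + 2 * W ^ (1 / p)) * K := by rw [mul_one]; gcongr; exact le_self_add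
  · set S := {x ∈ B | (t : ℝ≥0∞) < ‖f x - a‖ₑ}
    have hVt : V * K ≤ (t : ℝ≥0∞) / 2 := by
      rw [ENNReal.le_div_iff_mul_le (Or.inl two_ne_zero) (Or.inl ENNReal.ofNat_ne_top)]
      calc V * K * 2 = 2 * V * K := by ring
        _ ≤ t := ht
    have hS : S ⊆ {y ∈ B | (t : ℝ≥0∞) / 2 < ‖f y - c₀‖ₑ} := by
      rintro y ⟨hyB, hy⟩
      refine ⟨hyB, ?_⟩
      by_contra hlt
      refine absurd hy (not_lt.2 ?_)
      calc ‖f y - a‖ₑ = ‖(f y - c₀) - (a - c₀)‖ₑ := by ring_nf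
        _ ≤ ‖f y - c₀‖ₑ + ‖a - c₀‖ₑ := enorm_sub_le
        _ ≤ (t : ℝ≥0∞) / 2 + (t : ℝ≥0∞) / 2 := add_le_add (not_lt.1 hlt) (ha.trans hVt)
        _ = t := ENNReal.add_halves _
    have hpow : (t : ℝ≥0∞) ^ p * (μ S / μ B) ≤ (2 * K) ^ p * W := by
      rw [← mul_div_assoc]
      refine ENNReal.div_le_of_le_mul ?_
      have ht2 : (t : ℝ≥0∞) = 2 * (t / 2) :=
        (ENNReal.mul_div_cancel two_ne_zero ENNReal.ofNat_ne_top).symm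
      calc (t : ℝ≥0∞) ^ p * μ S = 2 ^ p * ((t / 2) ^ p * μ S) := by
            rw [← mul_assoc, ← ENNReal.mul_rpow_of_nonneg _ _ hp0.le, ← ht2]
        _ ≤ 2 ^ p * (W * K ^ p * μ B) := by
            gcongr 2 ^ p * ?_
            exact le_trans (by gcongr) (h _)
        _ = (2 * K) ^ p * W * μ B := by
            rw [ENNReal.mul_rpow_of_nonneg _ _ hp0.le]; ring
    have hcancel : ∀ z : ℝ≥0∞, (z ^ p) ^ (1 / p) = z := fun z => by
      rw [← ENNReal.rpow_mul, mul_one_div_cancel hp0.ne', ENNReal.rpow_one]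
    have hinv : (0 : ℝ) ≤ 1 / p := by positivity
    calc (t : ℝ≥0∞) * (μ S / μ B) ^ (1 / p)
        = ((t : ℝ≥0∞) ^ p * (μ S / μ B)) ^ (1 / p) := by
          rw [ENNReal.mul_rpow_of_nonneg _ _ hinv, hcancel]
      _ ≤ ((2 * K) ^ p * W) ^ (1 / p) := by gcongr
      _ = 2 * W ^ (1 / p) * K := by
          rw [ENNReal.mul_rpow_of_nonneg _ _ hinv, hcancel]; ring
      _ ≤ (2 * V + 2 * W ^ (1 / p)) * K := by gcongr; exact le_add_self

end

/-! ### The John-Nirenberg functional and the final assembly. -/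

section

variable {X : Type*} [MetricSpace X] [MeasurableSpace X] {μ : Measure X} {f : X → ℝ}
  {p τ ρ : ℝ} {A : Set X} {K : ℝ≥0∞}

theorem tsum_lpOscillation_le_of_jnNorm_le (hp : 0 < p) (hA0 : μ A ≠ 0) (hA : μ A ≠ ∞)
    (hK : jnNorm μ p τ ρ A f ≤ K) {S : Set (X × ℝ)} (hS : IsAdmissibleFamily τ A S) :
    ∑' b : S, lpOscillation μ ρ (ball b.1.1 b.1.2) f ^ (p / ρ) * μ (ball b.1.1 (τ * b.1.2)) ≤
      K ^ p * μ A := by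
  rw [← ENNReal.div_le_iff hA0 hA]
  have := (le_iSup₂ (f := fun (S : Set (X × ℝ)) (_ : IsAdmissibleFamily τ A S) =>
    ((∑' b : S, lpOscillation μ ρ (ball b.1.1 b.1.2) f ^ (p / ρ) *
      μ (ball b.1.1 (τ * b.1.2))) / μ A) ^ (1 / p)) S hS).trans hK
  rwa [one_div, ENNReal.rpow_inv_le_iff hp] at this

theorem lpOscillation_le_jnNorm_rpow (hp : 0 < p) (hρ : 0 < ρ) {x : X} {r : ℝ} (hr : 0 < r)
    (hA0 : μ (ball x (τ * r)) ≠ 0) (hA : μ (ball x (τ * r)) ≠ ∞) :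
    lpOscillation μ ρ (ball x r) f ≤ jnNorm μ p τ ρ (ball x (τ * r)) f ^ ρ := by
  have hadm : IsAdmissibleFamily τ (ball x (τ * r)) {(x, r)} :=
    ⟨by simpa using hr, by simp, pairwiseDisjoint_singleton _ _⟩
  have h := tsum_lpOscillation_le_of_jnNorm_le hp hA0 hA
    (le_refl (jnNorm μ p τ ρ (ball x (τ * r)) f)) hadm
  rw [tsum_singleton (x, r) (fun b : X × ℝ => lpOscillation μ ρ (ball b.1 b.2) f ^ (p / ρ) *
    μ (ball b.1 (τ * b.2))), ENNReal.mul_le_mul_iff_left hA0 hA] at h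
  have hq : 0 < p / ρ := div_pos hp hρ
  rwa [← ENNReal.rpow_le_rpow_iff hq, ← ENNReal.rpow_mul, mul_div_cancel₀ _ hρ.ne']

variable [BorelSpace X] {c : ℝ≥0}

/-- The weak type inequality for `f - c₀`, with `c₀` a near minimizer of the oscillation on the
enlarged ball. -/
theorem IsDoublingWith.exists_weak_type (h : IsDoublingWith μ c) (hp : 0 < p)
    (hρ : 0 < ρ) (hρ' : ρ ≤ 1) {η : ℝ} (hτ : 1 ≤ τ) (hη : 0 < η) {x₀ : X} {r : ℝ} (hr : 0 < r)
    {k l : ℕ} (hk : 4 * (1 + η) ≤ 2 ^ k * η) (hl : τ * (1 + η) ≤ 2 ^ l)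
    {θ N D : ℝ≥0∞} (hN : 4 ≤ N) (hcN : c ≤ N) (hN' : N ≠ ∞)
    (hθ0 : θ ≠ 0) (hθ : 4 * (c ^ 3 * N ^ (p / ρ) * θ) ≤ 1)
    (hD : 2 * (N ^ (p / ρ) * (c ^ 3 * (θ ^ (p / ρ))⁻¹)) ≤ D) (hD' : (2 * c ^ k) ^ (p / ρ) ≤ D)
    (hf : MemLp f (ENNReal.ofReal ρ) (μ.restrict (ball x₀ (τ * ((1 + η) * r)))))
    (hK : jnNorm μ p τ ρ (ball x₀ (τ * ((1 + η) * r))) f < K) (hK' : K ≠ ∞) :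
    ∃ c₀, ∀ t, t ^ p * μ {y ∈ ball x₀ r | t < ‖f y - c₀‖ₑ} ≤
      N ^ (p / ρ) * D * c ^ l * K ^ p * μ (ball x₀ r) := by
  have hτ0 : 0 < τ := by linarith
  have hq : 0 < p / ρ := div_pos hp hρ
  have hR : 0 < (1 + η) * r := by positivity
  have hτR : 0 < τ * ((1 + η) * r) := by positivity
  have hsub : ball x₀ ((1 + η) * r) ⊆ ball x₀ (τ * ((1 + η) * r)) :=
    ball_subset_ball (le_mul_of_one_le_left hR.le hτ)
  set A := ball x₀ (τ * ((1 + η) * r)) with hAdef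
  have hA0 : μ A ≠ 0 := (h.ball_pos _ _ hτR).ne'
  have hA1 : μ A ≠ ∞ := (h.ball_lt_top _ _ hτR).ne
  have hK0 : K ≠ 0 := (zero_le.trans_lt hK).ne'
  have hfA : AEMeasurable f (μ.restrict A) := hf.aestronglyMeasurable.aemeasurable
  have hpow : (K ^ ρ) ^ (p / ρ) = K ^ p := by
    rw [← ENNReal.rpow_mul, mul_div_cancel₀ _ hρ.ne']
  have hfin : ∫⁻ y in A, powDist ρ (f y) 0 ∂μ ≠ ∞ := by
    have := lintegral_rpow_enorm_lt_top_of_eLpNorm_lt_top (by simpa using hρ)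
      ENNReal.ofReal_ne_top hf.eLpNorm_lt_top
    rw [ENNReal.toReal_ofReal hρ.le] at this
    simpa [powDist] using this.ne
  have hosc : lpOscillation μ ρ (ball x₀ ((1 + η) * r)) f < K ^ ρ :=
    (lpOscillation_le_jnNorm_rpow hp hρ hR hA0 hA1).trans_lt (ENNReal.rpow_lt_rpow hK hρ)
  obtain ⟨c₀, hc₀⟩ := exists_lintegral_powDist_le (h.ball_pos _ _ hR).ne'
    (h.ball_lt_top _ _ hR).ne hosc
  have hleb := (h.ae_eventually_lintegral_powDist_le hρ hρ' isOpen_ball hA1 hfA hfin).mono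
    fun x hx hxb => hx (hsub hxb)
  have hκ : K ^ ρ ≠ 0 := by simp [hK0, hρ.le]
  have hκ' : K ^ ρ ≠ ∞ := ENNReal.rpow_ne_top_of_nonneg hρ.le hK'
  have hlevel := h.rpow_mul_measure_levelSet_pow_le hρ hρ' hτ hη hq hr hk (hfA.mono_set hsub)
    hκ hκ' hN hcN hN' hθ0 hθ hD hD' hleb (fun S hS => by
      rw [hpow]; exact tsum_lpOscillation_le_of_jnNorm_le hp hA0 hA1 hK.le hS) hc₀
  rw [← hAdef, hpow] at hlevel
  have hc1 : (1 : ℝ≥0∞) ≤ c := by exact_mod_cast h.one_le x₀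
  have hc0 : (c : ℝ≥0∞) ≠ 0 := (zero_lt_one.trans_le hc1).ne'
  have hrA : ball x₀ r ⊆ A := ball_subset_ball (by nlinarith)
  have hall := rpow_mul_measure_le_of_geometric (ν := μ.restrict (ball x₀ r))
    (g := fun y => powDist ρ (f y) c₀) (L₀ := 2 * c ^ k * K ^ ρ) (N := N)
    (M := D * (K ^ p * μ A)) hq (mul_ne_zero (mul_ne_zero two_ne_zero (pow_ne_zero _ hc0)) hκ)
    (ENNReal.mul_ne_top (ENNReal.mul_ne_top ENNReal.ofNat_ne_top
      (ENNReal.pow_ne_top ENNReal.coe_ne_top)) hκ') (le_trans (by norm_num) hN)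
    (by
      rw [Measure.restrict_apply_univ, ENNReal.mul_rpow_of_nonneg _ _ hq.le, hpow, mul_assoc]
      gcongr)
    (fun i => by
      refine le_trans ?_ (hlevel i)
      rw [Measure.restrict_apply' measurableSet_ball, inter_comm]
      gcongr
      exact le_mul_of_one_le_right hr.le (by linarith [show 0 ≤ η / 2 ^ i by positivity]))
  refine ⟨c₀, fun t => ?_⟩
  have hset : {y ∈ ball x₀ r | t < ‖f y - c₀‖ₑ} =
      {y | t ^ ρ < powDist ρ (f y) c₀} ∩ ball x₀ r := by
    ext y
    simp only [powDist, ENNReal.rpow_lt_rpow_iff hρ]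
    exact and_comm
  have ht := hall (t ^ ρ)
  rw [Measure.restrict_apply' measurableSet_ball, ← hset, ← ENNReal.rpow_mul,
    mul_div_cancel₀ _ hρ.ne'] at ht
  have hμA : μ A ≤ c ^ l * μ (ball x₀ r) := by
    refine h.measure_le_of_subset x₀ hr subset_rfl ?_
    rw [← mul_assoc]
    gcongr
  calc t ^ p * μ {y ∈ ball x₀ r | t < ‖f y - c₀‖ₑ}
      ≤ N ^ (p / ρ) * (D * (K ^ p * μ A)) := ht
    _ ≤ N ^ (p / ρ) * (D * (K ^ p * (c ^ l * μ (ball x₀ r)))) := by gcongr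
    _ = _ := by ring

end

theorem exists_weak_type_const {p ρ τ η : ℝ} (hp : 0 < p) (hρ : 0 < ρ) (hη : 0 < η)
    {c : ℝ≥0} (hc : 1 ≤ c) :
    ∃ (k l : ℕ) (θ N D : ℝ≥0∞), 4 * (1 + η) ≤ 2 ^ k * η ∧ τ * (1 + η) ≤ 2 ^ l ∧
      4 ≤ N ∧ c ≤ N ∧ N ≠ ∞ ∧ θ ≠ 0 ∧ 4 * (c ^ 3 * N ^ (p / ρ) * θ) ≤ 1 ∧
      2 * (N ^ (p / ρ) * (c ^ 3 * (θ ^ (p / ρ))⁻¹)) ≤ D ∧ (2 * c ^ k) ^ (p / ρ) ≤ D ∧ D ≠ ∞ := by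
  have hq : 0 < p / ρ := div_pos hp hρ
  obtain ⟨k, hk⟩ := pow_unbounded_of_one_lt (4 * (1 + η) / η) one_lt_two
  obtain ⟨l, hl⟩ := pow_unbounded_of_one_lt (τ * (1 + η)) one_lt_two
  have hc1 : (1 : ℝ≥0∞) ≤ c := by exact_mod_cast hc
  have hcpow : ∀ n : ℕ, (c : ℝ≥0∞) ^ n ≠ ∞ := fun n => ENNReal.pow_ne_top ENNReal.coe_ne_top
  -- The factor `4` separates consecutive levels in the stopping argument; the factor `c` beats the
  -- doubling loss `c ^ i` in the iteration.
  set N : ℝ≥0∞ := 4 * c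
  have hN4 : 4 ≤ N := le_mul_of_one_le_right' hc1
  have hN' : N ≠ ∞ := ENNReal.mul_ne_top ENNReal.ofNat_ne_top ENNReal.coe_ne_top
  have hNq' : N ^ (p / ρ) ≠ ∞ := ENNReal.rpow_ne_top_of_nonneg hq.le hN'
  set G : ℝ≥0∞ := 4 * (c ^ 3 * N ^ (p / ρ))
  have hG : G ≠ ∞ := ENNReal.mul_ne_top ENNReal.ofNat_ne_top (ENNReal.mul_ne_top (hcpow 3) hNq')
  refine ⟨k, l, G⁻¹, N, 2 * (N ^ (p / ρ) * (c ^ 3 * ((G⁻¹) ^ (p / ρ))⁻¹)) +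
    (2 * c ^ k) ^ (p / ρ), ?_, hl.le, hN4, ?_, hN', ENNReal.inv_ne_zero.2 hG, ?_, le_self_add,
    le_add_self, ?_⟩
  · exact ((div_lt_iff₀ hη).1 hk).le
  · exact le_mul_of_one_le_left' (by norm_num)
  · rw [← mul_assoc]
    exact ENNReal.mul_inv_le_one G
  · rw [ENNReal.inv_rpow, inv_inv]
    refine ENNReal.add_ne_top.2 ⟨ENNReal.mul_ne_top ENNReal.ofNat_ne_top
      (ENNReal.mul_ne_top hNq' (ENNReal.mul_ne_top (hcpow 3)
        (ENNReal.rpow_ne_top_of_nonneg hq.le hG))), ENNReal.rpow_ne_top_of_nonneg hq.le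
      (ENNReal.mul_ne_top ENNReal.ofNat_ne_top (hcpow k))⟩

theorem mainTheorem5 (p ρ τ η : ℝ) (hp : 1 < p) (hρ : 0 < ρ) (hρ' : ρ ≤ 1) (hτ : 1 ≤ τ)
    (hη : 0 < η) (c : ℝ≥0) :
    ∃ C : ℝ≥0, 0 < C ∧
      ∀ (X : Type*) [MetricSpace X] [MeasurableSpace X] [BorelSpace X] (μ : Measure X),
        IsDoublingWith μ c →
        ∀ (x : X) (r : ℝ), 0 < r →
        ∀ f : X → ℝ, MemLp f (ENNReal.ofReal ρ) (μ.restrict (ball x (τ * ((1 + η) * r)))) →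
          (jnNorm μ p τ ρ (ball x (τ * ((1 + η) * r))) f < ∞ →
            IntegrableOn f (ball x r) μ) ∧
          weakLpNorm μ p (ball x r) (fun y => f y - ⨍ z in ball x r, f z ∂μ) ≤
            C * jnNorm μ p τ ρ (ball x (τ * ((1 + η) * r))) f := by
  have hp0 : 0 < p := by linarith
  by_cases hc : 1 ≤ c
  swap
  -- A doubling constant below `1` leaves no point to center a ball at.
  · exact ⟨1, one_pos, fun X _ _ _ μ h x => absurd (h.one_le x) hc⟩
  obtain ⟨k, l, θ, N, D, hk, hl, hN, hcN, hN', hθ0, hθ, hD, hD', hDtop⟩ :=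
    exists_weak_type_const (τ := τ) hp0 hρ hη hc
  have hq : 0 < p / ρ := div_pos hp0 hρ
  set W := N ^ (p / ρ) * D * c ^ l
  have hW : W ≠ ∞ := ENNReal.mul_ne_top (ENNReal.mul_ne_top
    (ENNReal.rpow_ne_top_of_nonneg hq.le hN') hDtop) (ENNReal.pow_ne_top ENNReal.coe_ne_top)
  set V := weakToStrongConst p W
  have hC₀ : 2 * V + 2 * W ^ (1 / p) ≠ ∞ := ENNReal.add_ne_top.2
    ⟨ENNReal.mul_ne_top ENNReal.ofNat_ne_top (weakToStrongConst_ne_top hp hW),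
      ENNReal.mul_ne_top ENNReal.ofNat_ne_top
        (ENNReal.rpow_ne_top_of_nonneg (by positivity) hW)⟩
  refine ⟨(2 * V + 2 * W ^ (1 / p)).toNNReal + 1, by positivity, ?_⟩
  intro X _ _ _ μ h x r hr f hf
  set J := jnNorm μ p τ ρ (ball x (τ * ((1 + η) * r))) f
  have hB0 : μ (ball x r) ≠ 0 := (h.ball_pos x r hr).ne'
  have hB1 : μ (ball x r) ≠ ∞ := (h.ball_lt_top x r hr).ne
  have hfin : IsFiniteMeasure (μ.restrict (ball x r)) :=
    isFiniteMeasure_restrict.2 hB1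
  have hne : NeZero (μ.restrict (ball x r)) := ⟨by simpa [Measure.restrict_eq_zero] using hB0⟩
  -- A strict majorant `K` of `J` is nonzero even if `J = 0`, and it leaves room to choose near
  -- minimizers.
  have key : ∀ K : ℝ≥0∞, J < K → K ≠ ∞ → IntegrableOn f (ball x r) μ ∧
      weakLpNorm μ p (ball x r) (fun y => f y - ⨍ z in ball x r, f z ∂μ) ≤
        (2 * V + 2 * W ^ (1 / p)) * K := by
    intro K hK hK'
    obtain ⟨c₀, hc₀⟩ := h.exists_weak_type hp0 hρ hρ' hτ hη hr hk hl hN hcN hN' hθ0 hθ hD hD'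
      hf hK hK'
    have hsub : ball x r ⊆ ball x (τ * ((1 + η) * r)) :=
      ball_subset_ball (by nlinarith [mul_pos hη hr])
    obtain ⟨hint, hav⟩ := integrable_and_enorm_average_sub_le (ν := μ.restrict (ball x r)) hp hW
      (zero_le.trans_lt hK).ne' hK' (hf.aestronglyMeasurable.mono_set hsub) c₀ (fun t => by
        rw [Measure.restrict_apply' measurableSet_ball, inter_comm, Measure.restrict_apply_univ]
        exact hc₀ t)
    exact ⟨hint, weakLpNorm_sub_le hp0 hav hc₀⟩
  refine ⟨fun hJ => ?_, ?_⟩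
  · obtain ⟨K, hJK, hK⟩ := exists_between hJ
    exact (key K hJK hK.ne).1
  · push_cast
    rw [ENNReal.coe_toNNReal hC₀]
    set C := 2 * V + 2 * W ^ (1 / p)
    have hC0 : C + 1 ≠ 0 := by simp
    have hC1 : C + 1 ≠ ∞ := ENNReal.add_ne_top.2 ⟨hC₀, ENNReal.one_ne_top⟩
    rw [mul_comm, ← ENNReal.div_le_iff hC0 hC1]
    -- Let `K` decrease to `J`; for `J = ∞` there is no such `K` and nothing to prove.
    refine le_of_forall_gt_imp_ge_of_dense fun K hK => ?_
    rcases eq_or_ne K ∞ with rfl | hK'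
    · exact le_top
    · rw [ENNReal.div_le_iff hC0 hC1, mul_comm]
      exact (key K hK hK').2.trans (by gcongr; exact le_self_add)
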